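/- A tournament is a finite loopless directed graph in which any two distinct vertices $u,v$ are joined by exactly one edge, written $u\to v$ or $v\to u$. A set $X$ of vertices of a tournament $G$ is homogeneous if every vertex $v\in V(G)\setminus X$ satisfies either $v\to x$ for all $x\in X$ or $x\to v$ for all $x\in X$; $G$ is prime if it has no homogeneous set $X$ with $1<|X|<|V(G)|$. A set $X\subseteq V(G)$ is transitive if the subtournament induced on $X$ contains no cyclic triangle $a\to b\to c\to a$. Let $U_5$ be the tournament with vertices $v_1,\dots,v_5$ such that $v_2\to v_1$, and $v_i\to v_j$ if $j-i\equiv 1,2\pmod 5$ and $\{i,j\}\ne\{1,2\}$; $G$ is $U_5$-free if no induced subtournament of $G$ is isomorphic to $U_5$. For odd $n\ge 1$, let $T_n$ be the tournament with vertices $v_1,\dots,v_n$ such that $v_i\to v_j$ if and only if $j-i\equiv 1,2,\dots,(n-1)/2 \pmod n$. Theorem. Let $G$ be a prime tournament. Then $G$ is $U_5$-free if and only if either $G$ is isomorphic to $T_n$ for some odd $n\ge 1$, or $V(G)$ can be partitioned into (possibly empty) sets $X,Y,Z$ such that $X\cup Y$, $Y\cup Z$ and $Z\cup X$ are all transitive.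 -/

import Mathlib

/-- A tournament on the vertex set `V`: a loopless digraph in which any two distinct vertices
are joined by exactly one edge. -/
structure Tournament (V : Type*) extends Digraph V where
  loopless : ∀ v, ¬ Adj v v
  exactly_one : ∀ u v, u ≠ v → Xor (Adj u v) (Adj v u)

namespace Tournament

variable {V W : Type*}

/-- The subtournament `G[X]` induced on `X`. -/
def induce (G : Tournament V) (X : Set V) : Tournament X where
  Adj u v := G.Adj u v
  loopless v := G.loopless v
  exactly_one u v h := G.exactly_one u v (fun e => h (Subtype.ext e))

/-- Two tournaments are isomorphic. -/
def IsIsomorphic (G : Tournament V) (H : Tournament W) : Prop :=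
  Nonempty (G.Adj ≃r H.Adj)

/-- `G` has no subtournament isomorphic to `H`. -/
def IsFree (G : Tournament V) (H : Tournament W) : Prop :=
  ¬ ∃ X : Set V, (G.induce X).IsIsomorphic H

/-- A tournament with no cyclic triangle (the three vertices of a directed triangle are
automatically distinct, as there are no loops). -/
def IsTransitive (G : Tournament V) : Prop :=
  ¬ ∃ a b c : V, G.Adj a b ∧ G.Adj b c ∧ G.Adj c a

/-- The set `X` of vertices is transitive in `G`. -/
def IsTransitiveSet (G : Tournament V) (X : Set V) : Prop :=
  (G.induce X).IsTransitive

/-- Every vertex outside `X` either dominates all of `X` or is dominated by all of `X`. -/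
def IsHomogeneous (G : Tournament V) (X : Set V) : Prop :=
  ∀ v, v ∉ X → (∀ x ∈ X, G.Adj v x) ∨ (∀ x ∈ X, G.Adj x v)

/-- A (finite) tournament is prime if no homogeneous set `X` has `1 < |X| < |V(G)|`. -/
def IsPrime (G : Tournament V) : Prop :=
  ∀ X : Set V, G.IsHomogeneous X → ¬ (1 < X.ncard ∧ X.ncard < Nat.card V)

/-- The tournament `U₅`; the vertices `v₁, …, v₅` are `0, …, 4`, and subtraction is modulo 5. -/
def U5 : Tournament (Fin 5) where
  Adj i j := (i = 1 ∧ j = 0) ∨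
    (({i, j} : Finset (Fin 5)) ≠ {0, 1} ∧ (j - i = 1 ∨ j - i = 2))
  loopless := by decide
  exactly_one := by unfold Xor; decide

/-- The tournament `Tₙ` for odd `n`; the vertices `v₁, …, vₙ` are `0, …, n - 1`, and
`i → j` iff `j - i` is congruent to one of `1, …, (n - 1) / 2` modulo `n`. -/
def T (n : ℕ) (hn : Odd n) : Tournament (Fin n) where
  Adj i j := ∃ k : ℕ, 1 ≤ k ∧ k ≤ (n - 1) / 2 ∧ ((j : ℕ) : ℤ) - ((i : ℕ) : ℤ) ≡ k [ZMOD n]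
  loopless := by
    rintro v ⟨k, h1, h2, h⟩
    have hd := h.dvd
    rw [sub_self, sub_zero] at hd
    have := Nat.le_of_dvd h1 (Int.natCast_dvd_natCast.mp hd)
    omega
  exactly_one := by
    intro u v huv
    have hne : (u : ℕ) ≠ (v : ℕ) := fun e => huv (Fin.ext e)
    obtain ⟨m, hm⟩ := hn
    have key : ∀ a b : Fin n, (a : ℕ) ≠ (b : ℕ) →
        ((∃ k : ℕ, 1 ≤ k ∧ k ≤ (n - 1) / 2 ∧
          ((b : ℕ) : ℤ) - ((a : ℕ) : ℤ) ≡ k [ZMOD n]) ↔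
        (((a : ℕ) < b ∧ (b : ℕ) ≤ a + m) ∨ ((b : ℕ) + m + 1 ≤ a))) := by
      intro a b hab
      have ha := a.isLt
      have hb := b.isLt
      constructor
      · rintro ⟨k, h1, h2, h⟩
        obtain ⟨c, hc⟩ := h.dvd
        have c1 : c < 2 := by
          by_contra hcon
          have : (n : ℤ) * 2 ≤ n * c := by gcongr; omega
          omega
        have c2 : -1 < c := by
          by_contra hcon
          have : (n : ℤ) * c ≤ n * (-1) := by gcongr; omega
          omega
        have : c = 0 ∨ c = 1 := by omega
        rcases this with rfl | rfl <;> omega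
      · rintro (⟨h1, h2⟩ | h)
        · refine ⟨(b : ℕ) - a, by omega, by omega, ?_⟩
          rw [Nat.cast_sub h1.le]
        · refine ⟨(b : ℕ) + n - a, by omega, by omega, ?_⟩
          rw [Nat.cast_sub (by omega)]
          refine (Int.modEq_iff_dvd).mpr ⟨1, ?_⟩
          push_cast
          ring
    have hu := u.isLt
    have hv := v.isLt
    show Xor (∃ k : ℕ, _) (∃ k : ℕ, _)
    rw [key u v hne, key v u hne.symm]
    unfold Xor
    omega

end Tournament

/-! The forward direction splits on whether `G` contains a copy of `T₅`.

Without `T₅`, order the vertices by inclusion of out-neighbourhoods along arcs; incomparable means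
lying in a common cyclic triangle. Primeness forces three pairwise incomparable vertices to form a
cyclic triangle (`IsPrime.adj_of_incomparable`), and no four vertices have all their triples cyclic,
so antichains have at most three elements. Dilworth gives three chains; every cyclic triangle meets
all three, so any two have transitive union.

With `T₅`, `U₅`-freeness and primeness make every vertex a substitute for one of the five
(`IsPrime.isSomeTwin`). The five classes of substitutes are transitive and nearly circularly
ordered, so all in- and out-neighbourhoods are transitive. Sending `v` to the source of its
out-neighbourhood then defines a cyclic permutation for which arcs depend only on index differences,
and this forces `Tₙ`.

Conversely, out-neighbourhoods in `Tₙ` are transitive while one in `U₅` is not, and `U₅` admits no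
3-colouring in which every cyclic triangle is rainbow. -/

/-- **Dilworth's theorem** for finite posets: if every antichain in `s` has at most `k` elements,
then `s` is covered by `k` chains. -/
theorem Finset.exists_chain_coloring {α : Type*} [PartialOrder α] (s : Finset α) :
    ∀ k : ℕ, (∀ t ⊆ s, IsAntichain (· ≤ ·) (t : Set α) → t.card ≤ k) →
      ∃ f : α → ℕ, (∀ x ∈ s, f x < k) ∧
        ∀ x ∈ s, ∀ y ∈ s, f x = f y → x ≤ y ∨ y ≤ x := by
  classical
  induction s using Finset.strongInduction with
  | H s ih =>
  intro k hk
  rcases s.eq_empty_or_nonempty with rfl | hs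
  · exact ⟨fun _ => 0, by simp, by simp⟩
  obtain ⟨a, has, hamax⟩ := s.exists_maximal hs
  have hk1 : 1 ≤ k := by simpa using hk {a} (by simpa using has) (by simp)
  -- If removing the maximal element `a` lowers the width, `{a}` is a chain of its own, with colour
  -- `k - 1`.
  by_cases hsmall : ∀ t ⊆ s.erase a, IsAntichain (· ≤ ·) (t : Set α) → t.card ≤ k - 1
  · obtain ⟨f, hf1, hf2⟩ := ih _ (Finset.erase_ssubset has) (k - 1) hsmall
    have hlt : ∀ x ∈ s, x ≠ a → f x < k - 1 := fun x hx hxa =>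
      hf1 x (Finset.mem_erase.2 ⟨hxa, hx⟩)
    refine ⟨fun z => if z = a then k - 1 else f z, fun x hx => ?_, fun x hx y hy hxy => ?_⟩
    · by_cases hxa : x = a
      · simp [hxa]; omega
      · have := hlt x hx hxa
        simp [hxa]; omega
    · by_cases hxa : x = a <;> by_cases hya : y = a
      · exact Or.inl (hxa.trans hya.symm).le
      · have := hlt y hy hya
        simp [hxa, hya] at hxy; omega
      · have := hlt x hx hxa
        simp [hxa, hya] at hxy; omega
      · simp [hxa, hya] at hxy
        exact hf2 x (Finset.mem_erase.2 ⟨hxa, hx⟩) y (Finset.mem_erase.2 ⟨hya, hy⟩) hxy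
  have hk' : ∀ t ⊆ s.erase a, IsAntichain (· ≤ ·) (t : Set α) → t.card ≤ k := fun t ht =>
    hk t (ht.trans (Finset.erase_subset _ _))
  obtain ⟨f, hf1, hf2⟩ := ih _ (Finset.erase_ssubset has) k hk'
  -- every antichain of size `k` meets every chain
  have hmeet : ∀ t ⊆ s.erase a, IsAntichain (· ≤ ·) (t : Set α) → t.card = k →
      ∀ i < k, ∃ x ∈ t, f x = i := by
    intro t ht hta htk i hi
    have hinj : Set.InjOn f (t : Set α) := by
      intro x hx y hy hxy
      rcases hf2 x (ht hx) y (ht hy) hxy with h | h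
      · exact hta.eq hx hy h
      · exact (hta.eq hy hx h).symm
    have himg : t.image f = Finset.range k := by
      apply Finset.eq_of_subset_of_card_le
      · intro j hj
        obtain ⟨x, hx, rfl⟩ := Finset.mem_image.1 hj
        exact Finset.mem_range.2 (hf1 x (ht hx))
      · rw [Finset.card_image_of_injOn hinj, htk, Finset.card_range]
    have : i ∈ t.image f := by rw [himg]; exact Finset.mem_range.2 hi
    simpa using this
  push Not at hsmall
  obtain ⟨t₀, ht₀, hanti₀, hcard₀⟩ := hsmall
  have hcard₀' : t₀.card = k := le_antisymm (hk' t₀ ht₀ hanti₀) (by omega)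
  -- The members of chain `i` that lie on some antichain of size `k`; `x i` will be the largest. The
  -- `x i` form an antichain, so by the width bound some `x i` lies below `a`.
  let M : ℕ → Finset α := fun i => (s.erase a).filter fun x => f x = i ∧
    ∃ t ⊆ s.erase a, IsAntichain (· ≤ ·) (t : Set α) ∧ t.card = k ∧ x ∈ t
  have hMmem : ∀ i x, x ∈ M i ↔ x ∈ s.erase a ∧ f x = i ∧
      ∃ t ⊆ s.erase a, IsAntichain (· ≤ ·) (t : Set α) ∧ t.card = k ∧ x ∈ t := fun i x =>
    Finset.mem_filter
  have hmax : ∀ i, ∃ x, i < k → x ∈ M i ∧ ∀ y ∈ M i, y ≤ x := by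
    intro i
    by_cases hi : i < k
    · obtain ⟨x, hx, hxi⟩ := hmeet t₀ ht₀ hanti₀ hcard₀' i hi
      have hne : (M i).Nonempty := ⟨x, (hMmem i x).2 ⟨ht₀ hx, hxi, t₀, ht₀, hanti₀, hcard₀', hx⟩⟩
      obtain ⟨m, hm, hmm⟩ := (M i).exists_maximal hne
      refine ⟨m, fun _ => ⟨hm, fun y hy => ?_⟩⟩
      have hm' := (hMmem i m).1 hm
      have hy' := (hMmem i y).1 hy
      rcases hf2 m hm'.1 y hy'.1 (hm'.2.1.trans hy'.2.1.symm) with h | h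
      · exact hmm hy h
      · exact h
    · exact ⟨a, fun h => absurd h hi⟩
  choose x hx using hmax
  have hxs : ∀ i < k, x i ∈ s.erase a := fun i hi => ((hMmem _ _).1 (hx i hi).1).1
  have hfx : ∀ i < k, f (x i) = i := fun i hi => ((hMmem _ _).1 (hx i hi).1).2.1
  have hxx : ∀ i < k, ∀ j < k, i ≠ j → ¬ x j ≤ x i := by
    intro i hi j hj hij hle
    obtain ⟨t, ht, hta, htk, hxt⟩ := ((hMmem _ _).1 (hx i hi).1).2.2
    obtain ⟨y, hyt, hyj⟩ := hmeet t ht hta htk j hj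
    have hyx : y ≤ x j := (hx j hj).2 y ((hMmem _ _).2 ⟨ht hyt, hyj, t, ht, hta, htk, hyt⟩)
    have := hta.eq hyt hxt (hyx.trans hle)
    apply hij
    rw [← hfx i hi, ← this, hyj]
  have hexi : ∃ i < k, x i ≤ a := by
    by_contra! hcon
    let A := insert a ((Finset.range k).image x)
    have hAs : A ⊆ s := by
      intro y hy
      rcases Finset.mem_insert.1 hy with rfl | hy
      · exact has
      · obtain ⟨i, hi, rfl⟩ := Finset.mem_image.1 hy
        exact Finset.erase_subset _ _ (hxs i (Finset.mem_range.1 hi))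
    have hanti : IsAntichain (· ≤ ·) (A : Set α) := by
      intro y hy z hz hyz hle
      rcases Finset.mem_insert.1 hy with rfl | hy'
      · exact hyz (le_antisymm hle (hamax (hAs hz) hle))
      obtain ⟨i, hi, rfl⟩ := Finset.mem_image.1 hy'
      rcases Finset.mem_insert.1 hz with rfl | hz'
      · exact hcon i (Finset.mem_range.1 hi) hle
      obtain ⟨j, hj, rfl⟩ := Finset.mem_image.1 hz'
      refine hxx j (Finset.mem_range.1 hj) i (Finset.mem_range.1 hi) ?_ hle
      rintro rfl
      exact hyz rfl
    have hcard : A.card = k + 1 := by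
      rw [Finset.card_insert_of_notMem, Finset.card_image_of_injOn, Finset.card_range]
      · intro i hi j hj hij
        rw [← hfx i (by simpa using hi), ← hfx j (by simpa using hj)]
        exact congrArg f hij
      · intro h
        obtain ⟨i, hi, hia⟩ := Finset.mem_image.1 h
        exact (Finset.mem_erase.1 (hxs i (Finset.mem_range.1 hi))).1 hia
    have := hk A hAs hanti
    omega
  obtain ⟨i, hi, hia⟩ := hexi
  -- The chain to split off: `a` on top of the part of chain `i` below `x i`. An antichain of size
  -- `k` missing `a` meets chain `i` below `x i`, hence meets `K`, so the width drops.
  let K := s.filter fun z => z = a ∨ (z ∈ s.erase a ∧ f z = i ∧ z ≤ x i)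
  have hKmem : ∀ z, z ∈ K ↔ z ∈ s ∧ (z = a ∨ (z ∈ s.erase a ∧ f z = i ∧ z ≤ x i)) := fun z =>
    Finset.mem_filter
  have haK : a ∈ K := (hKmem a).2 ⟨has, Or.inl rfl⟩
  have hss : s \ K ⊂ s :=
    (Finset.ssubset_iff_of_subset Finset.sdiff_subset).2 ⟨a, has, by simp [haK]⟩
  obtain ⟨g, hg1, hg2⟩ := ih (s \ K) hss (k - 1) (by
    intro t ht hta
    by_contra hcon
    have hts : t ⊆ s.erase a := fun z hz => by
      have := Finset.mem_sdiff.1 (ht hz)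
      refine Finset.mem_erase.2 ⟨?_, this.1⟩
      rintro rfl
      exact this.2 haK
    have htk : t.card = k := le_antisymm (hk' t hts hta) (by omega)
    obtain ⟨z, hzt, hzi⟩ := hmeet t hts hta htk i hi
    have hzx : z ≤ x i := (hx i hi).2 z ((hMmem _ _).2 ⟨hts hzt, hzi, t, hts, hta, htk, hzt⟩)
    have := Finset.mem_sdiff.1 (ht hzt)
    exact this.2 ((hKmem z).2 ⟨this.1, Or.inr ⟨hts hzt, hzi, hzx⟩⟩))
  refine ⟨fun z => if z ∈ K then k - 1 else g z, fun z hz => ?_, fun z hz w hw hzw => ?_⟩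
  · by_cases hzK : z ∈ K
    · simp [hzK]; omega
    · have := hg1 z (Finset.mem_sdiff.2 ⟨hz, hzK⟩)
      simp [hzK]; omega
  · by_cases hzK : z ∈ K <;> by_cases hwK : w ∈ K
    · rcases ((hKmem z).1 hzK).2 with rfl | ⟨hz1, hz2, hz3⟩ <;>
        rcases ((hKmem w).1 hwK).2 with rfl | ⟨hw1, hw2, hw3⟩
      · exact Or.inl le_rfl
      · exact Or.inr (hw3.trans hia)
      · exact Or.inl (hz3.trans hia)
      · exact hf2 z hz1 w hw1 (hz2.trans hw2.symm)
    · have := hg1 w (Finset.mem_sdiff.2 ⟨hw, hwK⟩)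
      simp [hzK, hwK] at hzw; omega
    · have := hg1 z (Finset.mem_sdiff.2 ⟨hz, hzK⟩)
      simp [hzK, hwK] at hzw; omega
    · simp [hzK, hwK] at hzw
      exact hg2 z (Finset.mem_sdiff.2 ⟨hz, hzK⟩) w (Finset.mem_sdiff.2 ⟨hw, hwK⟩) hzw

/-! ### Basic facts, copies of `U₅`, and strong sets -/

namespace Tournament

variable {V W : Type*} {G : Tournament V}

theorem adj_asymm {a b : V} (h : G.Adj a b) : ¬ G.Adj b a := by
  intro h'
  by_cases hab : a = b
  · subst hab
    exact G.loopless a h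
  · rcases G.exactly_one a b hab with ⟨_, h2⟩ | ⟨_, h2⟩
    · exact h2 h'
    · exact h2 h

theorem adj_ne {a b : V} (h : G.Adj a b) : a ≠ b := by
  rintro rfl
  exact G.loopless a h

theorem adj_or_adj {a b : V} (h : a ≠ b) : G.Adj a b ∨ G.Adj b a := by
  rcases G.exactly_one a b h with ⟨h1, _⟩ | ⟨h1, _⟩
  · exact Or.inl h1
  · exact Or.inr h1

theorem adj_of_not_adj {a b : V} (h : a ≠ b) (h' : ¬ G.Adj a b) : G.Adj b a :=
  (adj_or_adj h).resolve_left h'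

theorem isTransitiveSet_iff {X : Set V} : G.IsTransitiveSet X ↔
    ∀ a ∈ X, ∀ b ∈ X, ∀ c ∈ X, G.Adj a b → G.Adj b c → ¬ G.Adj c a := by
  constructor
  · intro h a ha b hb c hc hab hbc hca
    exact h ⟨⟨a, ha⟩, ⟨b, hb⟩, ⟨c, hc⟩, hab, hbc, hca⟩
  · rintro h ⟨a, b, c, hab, hbc, hca⟩
    exact h a a.2 b b.2 c c.2 hab hbc hca

/-- A tournament is `H`-free if and only if there is no arc-preserving map from `H` into it. -/
theorem isFree_iff {H : Tournament W} :
    G.IsFree H ↔ ¬ ∃ f : W → V, ∀ i j, H.Adj i j → G.Adj (f i) (f j) := by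
  refine not_congr ⟨?_, ?_⟩
  · rintro ⟨X, ⟨e⟩⟩
    exact ⟨fun i => (e.symm i : V), fun i j h => e.symm.map_rel_iff.2 h⟩
  · rintro ⟨f, hf⟩
    have hinj : Function.Injective f := by
      intro i j hij
      by_contra hne
      rcases adj_or_adj (G := H) hne with h | h
      · exact adj_ne (hf _ _ h) hij
      · exact adj_ne (hf _ _ h) hij.symm
    have hiff : ∀ i j, G.Adj (f i) (f j) ↔ H.Adj i j := by
      refine fun i j => ⟨fun h => ?_, hf i j⟩
      by_contra hn
      have hij : i ≠ j := fun e => adj_ne h (congrArg f e)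
      exact adj_asymm h (hf _ _ (adj_of_not_adj hij hn))
    exact ⟨Set.range f, ⟨RelIso.symm ⟨Equiv.ofInjective f hinj, fun {i j} => hiff i j⟩⟩⟩

theorem IsFree.not_U5 (h : G.IsFree U5) {a b c d e : V} (hba : G.Adj b a) (hac : G.Adj a c)
    (hbc : G.Adj b c) (hbd : G.Adj b d) (hcd : G.Adj c d) (hce : G.Adj c e) (hde : G.Adj d e)
    (hda : G.Adj d a) (hea : G.Adj e a) (heb : G.Adj e b) : False := by
  refine isFree_iff.1 h ⟨![a, b, c, d, e], fun i j hij => ?_⟩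
  fin_cases i <;> fin_cases j <;> first | assumption | exact absurd hij (by unfold U5; decide)

/-- A set of vertices is strong if it has no proper nonempty part that dominates the rest. -/
def IsStrong (G : Tournament V) (C : Set V) : Prop :=
  ∀ D ⊆ C, D.Nonempty → (∀ d ∈ D, ∀ e ∈ C \ D, G.Adj d e) → D = C

theorem isStrong_triangle {x y z : V} (hxy : G.Adj x y) (hyz : G.Adj y z) (hzx : G.Adj z x) :
    G.IsStrong {x, y, z} := by
  intro D hD hne h
  have h1 : x ∈ D → z ∈ D := fun hx => by
    by_contra hz
    exact adj_asymm hzx (h x hx z ⟨by simp, hz⟩)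
  have h2 : y ∈ D → x ∈ D := fun hx => by
    by_contra hz
    exact adj_asymm hxy (h y hx x ⟨by simp, hz⟩)
  have h3 : z ∈ D → y ∈ D := fun hx => by
    by_contra hz
    exact adj_asymm hyz (h z hx y ⟨by simp, hz⟩)
  apply hD.antisymm
  obtain ⟨w, hw⟩ := hne
  have := hD hw
  simp only [Set.mem_insert_iff, Set.mem_singleton_iff] at this
  have key : x ∈ D ∧ y ∈ D ∧ z ∈ D := by
    rcases this with rfl | rfl | rfl <;> tauto
  rintro u (rfl | rfl | rfl)
  · exact key.1
  · exact key.2.1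
  · exact key.2.2

/-- A dominating part that meets `C` contains all of `C` by strength, and then `v`, since `v → c`;
one missing `C` is `{v}`, refuted by `c' → v`. -/
theorem IsStrong.insert {C : Set V} (hC : G.IsStrong C) {v c c' : V} (hv : v ∉ C) (hc : c ∈ C)
    (hc' : c' ∈ C) (hvc : G.Adj v c) (hcv : G.Adj c' v) : G.IsStrong (insert v C) := by
  intro D hD hne h
  by_cases hDC : (D ∩ C).Nonempty
  · have hCD : D ∩ C = C := hC _ Set.inter_subset_right hDC fun d hd e he =>
      h d hd.1 e ⟨Set.mem_insert_of_mem _ he.1, fun h' => he.2 ⟨h', he.1⟩⟩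
    have hCD' : C ⊆ D := Set.inter_eq_right.1 hCD
    refine hD.antisymm (Set.insert_subset ?_ hCD')
    by_contra hvD
    exact adj_asymm hvc (h c (hCD' hc) v ⟨Set.mem_insert _ _, hvD⟩)
  · have hnot : ∀ u ∈ C, u ∉ D := fun u hu hu' => hDC ⟨u, hu', hu⟩
    obtain ⟨d, hd⟩ := hne
    have hdv : d = v := (hD hd).resolve_right fun h' => hnot d h' hd
    subst hdv
    exact absurd (h d hd c' ⟨Set.mem_insert_of_mem _ hc', hnot c' hc'⟩) (adj_asymm hcv)

/-- If each vertex outside `A` splits `A` into two parts one of which dominates the other, then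
`A` is transitive: a maximal nontrivial strong subset of `A` would be homogeneous. -/
theorem IsPrime.not_triangle_of_split [Finite V] (hG : G.IsPrime) {A : Set V} (hA : A ≠ Set.univ)
    (h : ∀ v, v ∉ A → (∀ c ∈ A, ∀ c' ∈ A, G.Adj v c → G.Adj c' v → G.Adj c c') ∨
      (∀ c ∈ A, ∀ c' ∈ A, G.Adj v c → G.Adj c' v → G.Adj c' c))
    {x y z : V} (hx : x ∈ A) (hy : y ∈ A) (hz : z ∈ A)
    (hxy : G.Adj x y) (hyz : G.Adj y z) (hzx : G.Adj z x) : False := by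
  obtain ⟨C, hC0, ⟨hCA, hCs⟩, hCmax⟩ :=
    (Set.toFinite {C : Set V | C ⊆ A ∧ G.IsStrong C}).exists_le_maximal
      (a := {x, y, z}) ⟨by
        rintro u (rfl | rfl | rfl) <;> assumption, isStrong_triangle hxy hyz hzx⟩
  have hxC : x ∈ C := hC0 (by simp)
  have hyC : y ∈ C := hC0 (by simp)
  refine hG C (fun v hv => ?_) ⟨?_, ?_⟩
  · by_contra! hcon
    obtain ⟨⟨c', hc', hvc'⟩, c, hc, hcv⟩ := hcon
    have hvc' : G.Adj c' v := adj_of_not_adj (fun e => hv (e ▸ hc')) hvc'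
    have hcv : G.Adj v c := adj_of_not_adj (fun e => hv (e ▸ hc)) hcv
    -- A vertex mixed on `C` enlarges `C` if it lies in `A`; otherwise the split it induces on `C`
    -- contradicts strength.
    by_cases hvA : v ∈ A
    · exact hv (hCmax ⟨Set.insert_subset hvA hCA, hCs.insert hv hc hc' hcv hvc'⟩
        (Set.subset_insert v C) (Set.mem_insert v C))
    · rcases h v hvA with h | h
      · have : {u ∈ C | G.Adj v u} = C := hCs _ (Set.sep_subset _ _) ⟨c, hc, hcv⟩
          fun d hd e he => h d (hCA hd.1) e (hCA he.1) hd.2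
            (adj_of_not_adj (fun e' => hv (e' ▸ he.1)) fun h' => he.2 ⟨he.1, h'⟩)
        exact adj_asymm hvc' (this.ge hc').2
      · have : {u ∈ C | G.Adj u v} = C := hCs _ (Set.sep_subset _ _) ⟨c', hc', hvc'⟩
          fun d hd e he => h e (hCA he.1) d (hCA hd.1)
            (adj_of_not_adj (fun e' => hv (e' ▸ he.1)) fun h' => he.2 ⟨he.1, h'⟩) hd.2
        exact adj_asymm hcv (this.ge hc).2
  · exact (Set.one_lt_ncard (Set.toFinite C)).2 ⟨x, hxC, y, hyC, (adj_ne hxy)⟩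
  · rw [← Set.ncard_univ]
    refine Set.ncard_lt_ncard (Set.ssubset_univ_iff.2 ?_)
    rintro rfl
    exact hA (Set.univ_subset_iff.1 hCA)

/-! ### The case without `T₅`: domination order and three chains -/

/-- The vertices `a, b, c, d, e`, in this cyclic order, induce a copy of `T₅`. -/
structure IsT5 (G : Tournament V) (a b c d e : V) : Prop where
  ab : G.Adj a b
  ac : G.Adj a c
  bc : G.Adj b c
  bd : G.Adj b d
  cd : G.Adj c d
  ce : G.Adj c e
  de : G.Adj d e
  da : G.Adj d a
  ea : G.Adj e a
  eb : G.Adj e b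

/-- Two vertices that form cyclic triangles with a common arc lie in no common cyclic triangle. -/
theorem IsPrime.not_triangle_of_common_arc [Finite V] (hG : G.IsPrime) (hU : G.IsFree U5)
    (hT : ∀ a b c d e, ¬ G.IsT5 a b c d e) {a b p q r : V} (hab : G.Adj a b)
    (hbp : G.Adj b p) (hpa : G.Adj p a) (hbq : G.Adj b q) (hqa : G.Adj q a)
    (hpq : G.Adj p q) (hqr : G.Adj q r) (hrp : G.Adj r p) : False := by
  -- If two vertices of a cyclic triangle close the arc `a → b`, so does the third: of its other
  -- three attachments to `a` and `b`, two give `U₅` and one gives `T₅`.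
  have key : ∀ {p q r : V}, G.Adj b p → G.Adj p a → G.Adj b q → G.Adj q a → G.Adj p q →
      G.Adj q r → G.Adj r p → G.Adj b r ∧ G.Adj r a := by
    intro p q r hbp hpa hbq hqa hpq hqr hrp
    have hra : r ≠ a := by
      rintro rfl
      exact adj_asymm hpa hrp
    have hrb : r ≠ b := by
      rintro rfl
      exact adj_asymm hbq hqr
    rcases adj_or_adj (G := G) hra with h1 | h1 <;> rcases adj_or_adj (G := G) hrb with h2 | h2
    · exact (hU.not_U5 h1 hab h2 hrp hbp hbq hpq hpa hqa hqr).elim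
    · exact ⟨h2, h1⟩
    · exact (hT a r b p q ⟨h1, hab, h2, hrp, hbp, hbq, hpq, hpa, hqa, hqr⟩).elim
    · exact (hU.not_U5 h2 hrp hbp hbq hpq hpa hqa hqr h1 hab).elim
  obtain ⟨hbr, hra⟩ := key hbp hpa hbq hqa hpq hqr hrp
  refine hG.not_triangle_of_split (A := {c | G.Adj b c ∧ G.Adj c a}) ?_ ?_
    ⟨hbp, hpa⟩ ⟨hbq, hqa⟩ ⟨hbr, hra⟩ hpq hqr hrp
  · intro h
    exact G.loopless b (h.ge (Set.mem_univ b) : _ ∧ _).1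
  · refine fun v hv => Or.inr fun c hc c' hc' hvc hcv => ?_
    refine adj_of_not_adj (fun e => ?_) fun hcc => hv ?_
    · subst e
      exact adj_asymm hvc hcv
    · exact key hc.1 hc.2 hc'.1 hc'.2 hcc hcv hvc

/-- Vertices ordered by inclusion of out-neighbourhoods along arcs. Two vertices are incomparable
exactly when they lie in a common cyclic triangle. -/
abbrev dominationOrder (G : Tournament V) : PartialOrder V where
  le u v := u = v ∨ (G.Adj v u ∧ ∀ w, G.Adj u w → G.Adj v w)
  le_refl u := Or.inl rfl
  le_trans u v w := by
    rintro (rfl | ⟨h1, h2⟩) (rfl | ⟨h3, h4⟩)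
    · exact Or.inl rfl
    · exact Or.inr ⟨h3, h4⟩
    · exact Or.inr ⟨h1, h2⟩
    · exact Or.inr ⟨h4 _ h1, fun x hx => h4 _ (h2 x hx)⟩
  le_antisymm u v := by
    rintro (rfl | ⟨h1, -⟩) (h | ⟨h3, -⟩)
    · rfl
    · rfl
    · exact h.symm
    · exact absurd h1 (adj_asymm h3)

theorem exists_triangle_of_incomparable {u v : V} (huv : G.Adj u v)
    (h : ¬ G.dominationOrder.le v u) : ∃ w, G.Adj v w ∧ G.Adj w u := by
  by_contra! hcon
  refine h (Or.inr ⟨huv, fun w hw => ?_⟩)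
  refine adj_of_not_adj (fun e => ?_) (hcon w hw)
  subst e
  exact adj_asymm huv hw

theorem not_comparable_of_triangle {a b c : V} (hab : G.Adj a b) (hbc : G.Adj b c)
    (hca : G.Adj c a) : ¬ (G.dominationOrder.le a b ∨ G.dominationOrder.le b a) := by
  rintro ((h | h) | (h | h))
  · exact adj_ne hab h
  · exact adj_asymm hab h.1
  · exact adj_ne hab h.symm
  · exact adj_asymm hca (h.2 c hbc)

/-- Three pairwise incomparable vertices form a cyclic triangle. -/
theorem IsPrime.adj_of_incomparable [Finite V] (hG : G.IsPrime) (hU : G.IsFree U5)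
    (hT : ∀ a b c d e, ¬ G.IsT5 a b c d e) {x y z : V} (hxy : G.Adj x y) (hyz : G.Adj y z)
    (h1 : ¬ G.dominationOrder.le y x) (h2 : ¬ G.dominationOrder.le z y)
    (h3 : ¬ G.dominationOrder.le z x) (hxz : x ≠ z) : G.Adj z x := by
  refine adj_of_not_adj hxz fun hxz => ?_
  obtain ⟨w, hzw, hwx⟩ := exists_triangle_of_incomparable hxz h3
  have hwy : w ≠ y := by
    rintro rfl
    exact adj_asymm hyz hzw
  -- If `w → y`, then `x` and `y` both close the arc `z → w`; otherwise `y` and `z` both close `w →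
  -- x`. Either pair lies in a common triangle with some `r`.
  rcases adj_or_adj (G := G) hwy with h | h
  · obtain ⟨r, hyr, hrx⟩ := exists_triangle_of_incomparable hxy h1
    exact hG.not_triangle_of_common_arc hU hT hzw hwx hxz h hyz hxy hyr hrx
  · obtain ⟨r, hzr, hry⟩ := exists_triangle_of_incomparable hyz h2
    exact hG.not_triangle_of_common_arc hU hT hwx hxy h hxz hzw hyz hzr hry

/-- Four vertices cannot have all triples cyclic: given `x → y`, both other vertices `z, w` are
dominated by `y`, so `y, z, w` is not cyclic. -/
theorem IsPrime.antichain_card_le [Finite V] (hG : G.IsPrime) (hU : G.IsFree U5)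
    (hT : ∀ a b c d e, ¬ G.IsT5 a b c d e) (t : Finset V)
    (ht : IsAntichain G.dominationOrder.le (t : Set V)) : t.card ≤ 3 := by
  by_contra hcon
  obtain ⟨a, b, c, d, ha, hb, hc, hd, hab, hac, had, hbc, hbd, hcd⟩ :=
    Finset.three_lt_card_iff.1 (not_le.1 hcon)
  have key : ∀ x ∈ t, ∀ y ∈ t, ∀ z ∈ t, x ≠ y → y ≠ z → x ≠ z → G.Adj x y → G.Adj y z →
      G.Adj z x := fun x hx y hy z hz hxy hyz hxz h1 h2 =>
    hG.adj_of_incomparable hU hT h1 h2 (ht hy hx hxy.symm) (ht hz hy hyz.symm)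
      (ht hz hx hxz.symm) hxz
  have asymm : ∀ x y, G.Adj x y → ¬ G.Adj y x := fun x y h => adj_asymm h
  have total : ∀ x y, x ≠ y → G.Adj x y ∨ G.Adj y x := fun x y h => adj_or_adj h
  have cyc : ∀ x ∈ t, ∀ y ∈ t, ∀ z ∈ t, x ≠ y → y ≠ z → x ≠ z → G.Adj x y →
      G.Adj y z ∧ G.Adj z x := by
    intro x hx y hy z hz hxy hyz hxz h
    rcases total y z hyz with h1 | h1
    · exact ⟨h1, key x hx y hy z hz hxy hyz hxz h h1⟩
    · rcases total x z hxz with h2 | h2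
      · exact absurd (key x hx z hz y hy hxz hyz.symm hxy h2 h1) (asymm _ _ h)
      · exact absurd (key z hz x hx y hy hxz.symm hxy hyz.symm h2 h) (asymm _ _ h1)
  have no_arc : ∀ x ∈ t, ∀ y ∈ t, x ≠ y → ¬ G.Adj x y := by
    intro x hx y hy hxy h
    obtain ⟨z, hz, w, hw, hzx, hzy, hwx, hwy, hzw⟩ : ∃ z ∈ t, ∃ w ∈ t,
        z ≠ x ∧ z ≠ y ∧ w ≠ x ∧ w ≠ y ∧ z ≠ w := by
      grind
    have h1 := cyc x hx y hy z hz hxy hzy.symm hzx.symm h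
    have h2 := cyc x hx y hy w hw hxy hwy.symm hwx.symm h
    have h3 := (cyc y hy z hz w hw hzy.symm hzw hwy.symm h1.1).2
    exact asymm _ _ h2.1 h3
  rcases total a b hab with h | h
  · exact no_arc a ha b hb hab h
  · exact no_arc b hb a ha hab.symm h

theorem IsPrime.exists_partition [Finite V] (hG : G.IsPrime) (hU : G.IsFree U5)
    (hT : ∀ a b c d e, ¬ G.IsT5 a b c d e) :
    ∃ X Y Z : Set V, X ∪ Y ∪ Z = Set.univ ∧ Disjoint X Y ∧ Disjoint Y Z ∧ Disjoint Z X ∧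
      G.IsTransitiveSet (X ∪ Y) ∧ G.IsTransitiveSet (Y ∪ Z) ∧ G.IsTransitiveSet (Z ∪ X) := by
  have := Fintype.ofFinite V
  let _ := G.dominationOrder
  obtain ⟨f, hf1, hf2⟩ := (Finset.univ : Finset V).exists_chain_coloring 3 fun t _ ht =>
    hG.antichain_card_le hU hT t ht
  -- Vertices of a cyclic triangle are incomparable, so a triangle uses all three colours.
  have hf3 : ∀ a b c, G.Adj a b → G.Adj b c → G.Adj c a → f a ≠ f b := fun a b c h1 h2 h3 h =>
    not_comparable_of_triangle h1 h2 h3 (hf2 a (Finset.mem_univ a) b (Finset.mem_univ b) h)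
  have key : ∀ i j, G.IsTransitiveSet ({v | f v = i} ∪ {v | f v = j}) := by
    refine fun i j => isTransitiveSet_iff.2 fun a ha b hb c hc h1 h2 h3 => ?_
    have e1 := hf3 a b c h1 h2 h3
    have e2 := hf3 b c a h2 h3 h1
    have e3 := hf3 c a b h3 h1 h2
    simp only [Set.mem_union, Set.mem_ofPred_eq] at ha hb hc
    omega
  have hdis : ∀ i j, i ≠ j → Disjoint {v | f v = i} {v | f v = j} := fun i j hij =>
    Set.disjoint_left.2 fun v hv hv' => hij (hv.symm.trans hv')
  refine ⟨{v | f v = 0}, {v | f v = 1}, {v | f v = 2}, ?_, hdis _ _ (by decide),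
    hdis _ _ (by decide), hdis _ _ (by decide), key _ _, key _ _, key _ _⟩
  ext v
  have := hf1 v (Finset.mem_univ v)
  simp only [Set.mem_union, Set.mem_ofPred_eq, Set.mem_univ, iff_true]
  omega

/-! ### Copies of `T₅` and the vertices that can replace theirs -/

variable {a b c d e : V}

theorem IsT5.rotate (h : G.IsT5 a b c d e) : G.IsT5 b c d e a :=
  ⟨h.bc, h.bd, h.cd, h.ce, h.de, h.da, h.ea, h.eb, h.ab, h.ac⟩

/-- The vertex `v` dominates `b, c` and is dominated by `d, e`. If `a, b, c, d, e` induce `T₅`,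
these are exactly the vertices (`a` among them) that can replace `a`. -/
structure IsTwin (G : Tournament V) (b c d e v : V) : Prop where
  b : G.Adj v b
  c : G.Adj v c
  d : G.Adj d v
  e : G.Adj e v

theorem IsT5.isTwin (h : G.IsT5 a b c d e) : G.IsTwin b c d e a := ⟨h.ab, h.ac, h.da, h.ea⟩

theorem IsT5.replace (h : G.IsT5 a b c d e) {v : V} (hv : G.IsTwin b c d e v) :
    G.IsT5 v b c d e :=
  ⟨hv.b, hv.c, h.bc, h.bd, h.cd, h.ce, h.de, hv.d, hv.e, h.eb⟩

/-- `v` can replace some vertex of `a, b, c, d, e`. -/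
def IsSomeTwin (G : Tournament V) (a b c d e v : V) : Prop :=
  G.IsTwin b c d e v ∨ G.IsTwin c d e a v ∨ G.IsTwin d e a b v ∨ G.IsTwin e a b c v ∨
    G.IsTwin a b c d v

/-- Up to rotation, the out-neighbour patterns that create `U₅`: one vertex, four vertices, and two
or three vertices that are not cyclically consecutive. -/
theorem IsFree.mixed_pattern (hU : G.IsFree U5) (h : G.IsT5 a b c d e) (v : V) :
    ¬ (G.Adj v a ∧ G.Adj b v ∧ G.Adj c v ∧ G.Adj d v ∧ G.Adj e v) ∧
    ¬ (G.Adj a v ∧ G.Adj v b ∧ G.Adj v c ∧ G.Adj v d ∧ G.Adj v e) ∧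
    ¬ (G.Adj v a ∧ G.Adj b v ∧ G.Adj v c ∧ G.Adj d v ∧ G.Adj e v) ∧
    ¬ (G.Adj v a ∧ G.Adj v b ∧ G.Adj c v ∧ G.Adj v d ∧ G.Adj e v) := by
  refine ⟨?_, ?_, ?_, ?_⟩
  · rintro ⟨h1, h2, h3, h4, h5⟩
    exact hU.not_U5 h5 h1 h.ea h.eb h.ab h.ac h.bc h2 h3 h.ce
  · rintro ⟨h1, h2, h3, h4, h5⟩
    exact hU.not_U5 h2 h.bd h4 h5 h.de h.da h.ea h.eb h.ab h1
  · rintro ⟨h1, h2, h3, h4, h5⟩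
    exact hU.not_U5 h.bc h.cd h.bd h2 h4 h.da h1 h3 h.ac h.ab
  · rintro ⟨h1, h2, h3, h4, h5⟩
    exact hU.not_U5 h.cd h.de h.ce h3 h5 h.eb h2 h4 h.bd h.bc

/-- The patterns left are all, none, and two or three consecutive out-neighbours. With
out-neighbours `b, c` or `a, b, c`, the vertex replaces `a`. -/
theorem IsFree.dominates_or_twin (hU : G.IsFree U5) (h : G.IsT5 a b c d e) (v : V) :
    (G.Adj v a ∧ G.Adj v b ∧ G.Adj v c ∧ G.Adj v d ∧ G.Adj v e) ∨
    (G.Adj a v ∧ G.Adj b v ∧ G.Adj c v ∧ G.Adj d v ∧ G.Adj e v) ∨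
    G.IsSomeTwin a b c d e v := by
  have r1 := h.rotate
  have r2 := r1.rotate
  have r3 := r2.rotate
  have r4 := r3.rotate
  by_cases ha : v = a
  · subst ha; exact Or.inr (Or.inr (Or.inl h.isTwin))
  by_cases hb : v = b
  · subst hb; exact Or.inr (Or.inr (Or.inr (Or.inl r1.isTwin)))
  by_cases hc : v = c
  · subst hc; exact Or.inr (Or.inr (Or.inr (Or.inr (Or.inl r2.isTwin))))
  by_cases hd : v = d
  · subst hd; exact Or.inr (Or.inr (Or.inr (Or.inr (Or.inr (Or.inl r3.isTwin)))))
  by_cases he : v = e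
  · subst he; exact Or.inr (Or.inr (Or.inr (Or.inr (Or.inr (Or.inr r4.isTwin)))))
  have p0 := hU.mixed_pattern h v
  have p1 := hU.mixed_pattern r1 v
  have p2 := hU.mixed_pattern r2 v
  have p3 := hU.mixed_pattern r3 v
  have p4 := hU.mixed_pattern r4 v
  have tw : ∀ b c d e, G.Adj v b → G.Adj v c → G.Adj d v → G.Adj e v → G.IsTwin b c d e v :=
    fun b c d e h1 h2 h3 h4 => ⟨h1, h2, h3, h4⟩
  unfold IsSomeTwin
  rcases adj_or_adj (G := G) ha with a1 | a1 <;> rcases adj_or_adj (G := G) hb with b1 | b1 <;>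
  rcases adj_or_adj (G := G) hc with c1 | c1 <;> rcases adj_or_adj (G := G) hd with d1 | d1 <;>
  rcases adj_or_adj (G := G) he with e1 | e1 <;>
  simp only [a1, b1, c1, d1, e1, and_true, not_true_eq_false, true_and,
    false_and, and_false] at p0 p1 p2 p3 p4 <;>
  simp [*]

/-- In a prime `U₅`-free tournament, every vertex can replace some vertex of each copy
of `T₅`. -/
theorem IsPrime.isSomeTwin [Finite V] (hG : G.IsPrime) (hU : G.IsFree U5)
    (h : G.IsT5 a b c d e) (v : V) : G.IsSomeTwin a b c d e v := by
  have asymm : ∀ x y, G.Adj x y → ¬ G.Adj y x := fun x y h => adj_asymm h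
  -- Once `x` replaces `a`, `v` dominates four vertices of the new copy; a substitute dominates at
  -- most three, so `v` dominates `x` too. Hence the set of all substitutes is homogeneous.
  have out : ∀ {a b c d e v x : V}, G.IsT5 a b c d e → G.IsTwin b c d e x → G.Adj v b →
      G.Adj v c → G.Adj v d → G.Adj v e → G.Adj v x := by
    intro a b c d e v x h hx h1 h2 h3 h4
    rcases hU.dominates_or_twin (h.replace hx) v with h' | h' | h' | h' | h' | h' | h'
    · exact h'.1
    · exact absurd h'.2.1 (asymm _ _ h1)
    · exact absurd h'.d (asymm _ _ h3)
    · exact absurd h'.d (asymm _ _ h4)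
    · exact absurd h'.e (asymm _ _ h1)
    · exact absurd h'.d (asymm _ _ h1)
    · exact absurd h'.d (asymm _ _ h2)
  have inn : ∀ {a b c d e v x : V}, G.IsT5 a b c d e → G.IsTwin b c d e x → G.Adj b v →
      G.Adj c v → G.Adj d v → G.Adj e v → G.Adj x v := by
    intro a b c d e v x h hx h1 h2 h3 h4
    rcases hU.dominates_or_twin (h.replace hx) v with h' | h' | h' | h' | h' | h' | h'
    · exact absurd h'.2.1 (asymm _ _ h1)
    · exact h'.1
    · exact absurd h'.b (asymm _ _ h1)
    · exact absurd h'.b (asymm _ _ h2)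
    · exact absurd h'.b (asymm _ _ h3)
    · exact absurd h'.b (asymm _ _ h4)
    · exact absurd h'.c (asymm _ _ h1)
  have r1 := h.rotate
  have r2 := r1.rotate
  have r3 := r2.rotate
  have r4 := r3.rotate
  by_contra hv
  refine hG {x | G.IsSomeTwin a b c d e x} (fun u hu => ?_) ⟨?_, ?_⟩
  · rcases hU.dominates_or_twin h u with ⟨h1, h2, h3, h4, h5⟩ | ⟨h1, h2, h3, h4, h5⟩ | h'
    · left
      rintro x (hx | hx | hx | hx | hx)
      · exact out h hx h2 h3 h4 h5
      · exact out r1 hx h3 h4 h5 h1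
      · exact out r2 hx h4 h5 h1 h2
      · exact out r3 hx h5 h1 h2 h3
      · exact out r4 hx h1 h2 h3 h4
    · right
      rintro x (hx | hx | hx | hx | hx)
      · exact inn h hx h2 h3 h4 h5
      · exact inn r1 hx h3 h4 h5 h1
      · exact inn r2 hx h4 h5 h1 h2
      · exact inn r3 hx h5 h1 h2 h3
      · exact inn r4 hx h1 h2 h3 h4
    · exact absurd h' hu
  · exact (Set.one_lt_ncard (Set.toFinite _)).2
      ⟨a, Or.inl h.isTwin, b, Or.inr (Or.inl r1.isTwin), adj_ne h.ab⟩
  · rw [← Set.ncard_univ]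
    refine Set.ncard_lt_ncard (Set.ssubset_univ_iff.2 fun heq => hv ?_)
    exact heq.ge (Set.mem_univ v)

/-- In the copy `x, b, c, d, e`, the arc `y → x` would give `y` a forbidden out-pattern containing
`c, d, x` but not `e`. -/
theorem IsPrime.adj_of_isTwin [Finite V] (hG : G.IsPrime) (hU : G.IsFree U5)
    (h : G.IsT5 a b c d e) {x y : V} (hx : G.IsTwin b c d e x) (hy : G.IsTwin c d e a y) : G.Adj x y := by
  rcases hG.isSomeTwin hU (h.replace hx) y with h' | h' | h' | h' | h'
  · exact absurd h'.d (adj_asymm hy.c)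
  · exact h'.e
  · exact h'.d
  · exact absurd h'.b (adj_asymm hy.d)
  · exact absurd h'.d (adj_asymm hy.b)

/-- Otherwise `b` is the only out-neighbour of `x` in the copy `w, b, y, d, e`. -/
theorem IsPrime.adj_of_isTwin_of_adj_left [Finite V] (hG : G.IsPrime) (hU : G.IsFree U5)
    (h : G.IsT5 a b c d e) {w x y : V} (hw : G.IsTwin b c d e w) (hx : G.IsTwin b c d e x)
    (hy : G.IsTwin d e a b y) (hwx : G.Adj w x) (hwy : G.Adj w y) : G.Adj x y := by
  have h1 : G.IsT5 w b y d e :=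
    ⟨hw.b, hwy, hy.e, h.bd, hy.b, hy.c, h.de, hw.d, hw.e, h.eb⟩
  rcases hG.isSomeTwin hU h1 x with h' | h' | h' | h' | h'
  · exact h'.c
  · exact h'.b
  · exact absurd h'.b (adj_asymm hx.d)
  · exact absurd h'.b (adj_asymm hx.e)
  · exact absurd h'.b (adj_asymm hwx)

/-- Otherwise `e` is the only in-neighbour of `x` in the copy `w, b, c, y, e`. -/
theorem IsPrime.adj_of_isTwin_of_adj_right [Finite V] (hG : G.IsPrime) (hU : G.IsFree U5)
    (h : G.IsT5 a b c d e) {w x y : V} (hw : G.IsTwin b c d e w) (hx : G.IsTwin b c d e x)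
    (hy : G.IsTwin e a b c y) (hxw : G.Adj x w) (hyw : G.Adj y w) : G.Adj y x := by
  have h1 : G.IsT5 w b c y e :=
    ⟨hw.b, hw.c, h.bc, hy.d, hy.e, h.ce, hy.b, hyw, hw.e, h.eb⟩
  rcases hG.isSomeTwin hU h1 x with h' | h' | h' | h' | h'
  · exact h'.d
  · exact absurd h'.e (adj_asymm hxw)
  · exact absurd h'.c (adj_asymm hx.e)
  · exact absurd h'.b (adj_asymm hx.e)
  · exact h'.e

/-- A vertex of another class is mixed on the class of `a` only if it replaces `c` or `d`, and then
its out-neighbours there dominate its in-neighbours, so the splitting criterion applies. -/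
theorem IsPrime.not_triangle_of_isTwin [Finite V] (hG : G.IsPrime) (hU : G.IsFree U5)
    (h : G.IsT5 a b c d e) {x y z : V} (hx : G.IsTwin b c d e x) (hy : G.IsTwin b c d e y)
    (hz : G.IsTwin b c d e z) (hxy : G.Adj x y) (hyz : G.Adj y z) (hzx : G.Adj z x) : False := by
  refine hG.not_triangle_of_split (A := {v | G.IsTwin b c d e v}) ?_ ?_ hx hy hz hxy hyz hzx
  · intro h
    exact G.loopless b (h.ge (Set.mem_univ b) : G.IsTwin b c d e b).b
  · refine fun v hv => Or.inl fun p hp q hq hvp hqv => ?_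
    have hqp : q ≠ p := by
      rintro rfl
      exact adj_asymm hvp hqv
    refine adj_of_not_adj hqp fun hqp => ?_
    rcases hG.isSomeTwin hU h v with h' | h' | h' | h' | h'
    · exact hv h'
    · exact adj_asymm hvp (hG.adj_of_isTwin hU h hp h')
    · exact adj_asymm hvp (hG.adj_of_isTwin_of_adj_left hU h hq hp h' hqp hqv)
    · exact adj_asymm hqv (hG.adj_of_isTwin_of_adj_right hU h hp hq h' hqp hvp)
    · exact adj_asymm hqv (hG.adj_of_isTwin hU h.rotate.rotate.rotate.rotate h' hq)

/-! ### Local transitivity -/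

/-- In- and out-neighbourhoods contain no cyclic triangle. -/
structure IsLocallyTransitive (G : Tournament V) : Prop where
  out : ∀ {v x y z}, G.Adj v x → G.Adj v y → G.Adj v z → G.Adj x y → G.Adj y z → ¬ G.Adj z x
  inn : ∀ {v x y z}, G.Adj x v → G.Adj y v → G.Adj z v → G.Adj x y → G.Adj y z → ¬ G.Adj z x

theorem IsPrime.exists_isT5_of_isT5 [Finite V] (hG : G.IsPrime) (hU : G.IsFree U5)
    (h : G.IsT5 a b c d e) (v : V) : ∃ b' c' d' e', G.IsT5 v b' c' d' e' := by
  rcases hG.isSomeTwin hU h v with h' | h' | h' | h' | h'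
  · exact ⟨_, _, _, _, h.replace h'⟩
  · exact ⟨_, _, _, _, h.rotate.replace h'⟩
  · exact ⟨_, _, _, _, h.rotate.rotate.replace h'⟩
  · exact ⟨_, _, _, _, h.rotate.rotate.rotate.replace h'⟩
  · exact ⟨_, _, _, _, h.rotate.rotate.rotate.rotate.replace h'⟩

/-- If `P, Q, R` are pairwise dominating in this order and contain no cyclic triangle, then
neither does their union. -/
theorem not_triangle_of_three {P Q R : V → Prop}
    (hPQ : ∀ x y, P x → Q y → G.Adj x y) (hQR : ∀ x y, Q x → R y → G.Adj x y)
    (hPR : ∀ x y, P x → R y → G.Adj x y)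
    (hP : ∀ x y z, P x → P y → P z → G.Adj x y → G.Adj y z → ¬ G.Adj z x)
    (hQ : ∀ x y z, Q x → Q y → Q z → G.Adj x y → G.Adj y z → ¬ G.Adj z x)
    (hR : ∀ x y z, R x → R y → R z → G.Adj x y → G.Adj y z → ¬ G.Adj z x)
    {x y z : V} (hx : P x ∨ Q x ∨ R x) (hy : P y ∨ Q y ∨ R y) (hz : P z ∨ Q z ∨ R z)
    (hxy : G.Adj x y) (hyz : G.Adj y z) : ¬ G.Adj z x := by
  intro hzx
  have n1 := adj_asymm hxy
  have n2 := adj_asymm hyz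
  have n3 := adj_asymm hzx
  rcases hx with hx | hx | hx <;> rcases hy with hy | hy | hy <;> rcases hz with hz | hz | hz <;>
  first
  | exact hP x y z hx hy hz hxy hyz hzx
  | exact hQ x y z hx hy hz hxy hyz hzx
  | exact hR x y z hx hy hz hxy hyz hzx
  | exact n1 (hPQ _ _ hy hx)
  | exact n1 (hQR _ _ hy hx)
  | exact n1 (hPR _ _ hy hx)
  | exact n2 (hPQ _ _ hz hy)
  | exact n2 (hQR _ _ hz hy)
  | exact n2 (hPR _ _ hz hy)
  | exact n3 (hPQ _ _ hx hz)
  | exact n3 (hQR _ _ hx hz)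
  | exact n3 (hPR _ _ hx hz)

/-- Put `v` in place of `a`. Its out-neighbours lie in its own class, that of `b` or that of `c`;
its in-neighbours lie in that of `d`, that of `e` or its own. Each triple, with its own class cut
down to the relevant neighbours, is dominating in this order. -/
theorem IsPrime.isLocallyTransitive_of_isT5 [Finite V] (hG : G.IsPrime) (hU : G.IsFree U5)
    (h : G.IsT5 a b c d e) : G.IsLocallyTransitive := by
  constructor
  · intro v x y z hvx hvy hvz
    obtain ⟨b, c, d, e, h⟩ := hG.exists_isT5_of_isT5 hU h v
    have cls : ∀ u, G.Adj v u →
        (G.IsTwin b c d e u ∧ G.Adj v u) ∨ G.IsTwin c d e v u ∨ G.IsTwin d e v b u := by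
      intro u hu
      rcases hG.isSomeTwin hU h u with h' | h' | h' | h' | h'
      · exact Or.inl ⟨h', hu⟩
      · exact Or.inr (Or.inl h')
      · exact Or.inr (Or.inr h')
      · exact absurd h'.c (adj_asymm hu)
      · exact absurd h'.b (adj_asymm hu)
    exact not_triangle_of_three (P := fun u => G.IsTwin b c d e u ∧ G.Adj v u)
      (Q := fun u => G.IsTwin c d e v u) (R := fun u => G.IsTwin d e v b u)
      (fun x y hx hy => hG.adj_of_isTwin hU h hx.1 hy)
      (fun x y hx hy => hG.adj_of_isTwin hU h.rotate hx hy)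
      (fun x y hx hy => hG.adj_of_isTwin_of_adj_left hU h h.isTwin hx.1 hy hx.2 hy.d)
      (fun x y z hx hy hz => hG.not_triangle_of_isTwin hU h hx.1 hy.1 hz.1)
      (fun x y z hx hy hz => hG.not_triangle_of_isTwin hU h.rotate hx hy hz)
      (fun x y z hx hy hz => hG.not_triangle_of_isTwin hU h.rotate.rotate hx hy hz)
      (cls x hvx) (cls y hvy) (cls z hvz)
  · intro v x y z hvx hvy hvz
    obtain ⟨b, c, d, e, h⟩ := hG.exists_isT5_of_isT5 hU h v
    have cls : ∀ u, G.Adj u v →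
        G.IsTwin e v b c u ∨ G.IsTwin v b c d u ∨ (G.IsTwin b c d e u ∧ G.Adj u v) := by
      intro u hu
      rcases hG.isSomeTwin hU h u with h' | h' | h' | h' | h'
      · exact Or.inr (Or.inr ⟨h', hu⟩)
      · exact absurd h'.e (adj_asymm hu)
      · exact absurd h'.d (adj_asymm hu)
      · exact Or.inl h'
      · exact Or.inr (Or.inl h')
    have h3 := h.rotate.rotate.rotate
    exact not_triangle_of_three (P := fun u => G.IsTwin e v b c u)
      (Q := fun u => G.IsTwin v b c d u) (R := fun u => G.IsTwin b c d e u ∧ G.Adj u v)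
      (fun x y hx hy => hG.adj_of_isTwin hU h3 hx hy)
      (fun x y hx hy => hG.adj_of_isTwin hU h3.rotate hx hy.1)
      (fun x y hx hy => hG.adj_of_isTwin_of_adj_right hU h h.isTwin hy.1 hx hy.2 hx.c)
      (fun x y z hx hy hz => hG.not_triangle_of_isTwin hU h3 hx hy hz)
      (fun x y z hx hy hz => hG.not_triangle_of_isTwin hU h3.rotate hx hy hz)
      (fun x y z hx hy hz => hG.not_triangle_of_isTwin hU h hx.1 hy.1 hz.1)
      (cls x hvx) (cls y hvy) (cls z hvz)

/-! ### The successor permutation and the isomorphism with `Tₙ` -/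

theorem IsPrime.exists_adj [Finite V] (hG : G.IsPrime) (hV : 3 ≤ Nat.card V) (v : V) :
    ∃ w, G.Adj v w := by
  by_contra! hcon
  have hcard : ({v}ᶜ : Set V).ncard = Nat.card V - 1 := by
    rw [Set.ncard_compl, Set.ncard_singleton]
  refine hG {v}ᶜ (fun u hu => Or.inr fun x hx => ?_) ⟨by omega, by omega⟩
  obtain rfl : u = v := by simpa using hu
  exact adj_of_not_adj (fun e => hx e.symm) (hcon x)

/-- A nonempty finite set without cyclic triangles has a source. -/
theorem exists_source [Finite V] {S : Set V} (hS : S.Nonempty)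
    (h : ∀ x ∈ S, ∀ y ∈ S, ∀ z ∈ S, G.Adj x y → G.Adj y z → ¬ G.Adj z x) :
    ∃ u ∈ S, ∀ w ∈ S, w = u ∨ G.Adj u w := by
  obtain ⟨u, hu, hmax⟩ := (Set.toFinite S).exists_maximalFor
    (fun u => {x ∈ S | G.Adj u x}.ncard) S hS
  refine ⟨u, hu, fun w hw => ?_⟩
  by_contra! hcon
  have hwu : G.Adj w u := adj_of_not_adj hcon.1.symm hcon.2
  have hss : {x ∈ S | G.Adj u x} ⊂ {x ∈ S | G.Adj w x} := by
    have hsub : {x ∈ S | G.Adj u x} ⊆ {x ∈ S | G.Adj w x} := fun x hx => ⟨hx.1, ?_⟩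
    · exact (Set.ssubset_iff_of_subset hsub).2 ⟨u, ⟨hu, hwu⟩, fun h' => G.loopless u h'.2⟩
    refine adj_of_not_adj (fun e => ?_) fun hxw => h u hu x hx.1 w hw hx.2 hxw hwu
    subst e
    exact adj_asymm hwu hx.2
  have hlt := Set.ncard_lt_ncard hss
  exact absurd (hmax hw hlt.le) (not_le.2 hlt)

/-- `σ v` is the source of the out-neighbourhood of `v`, for every `v`. -/
structure IsSucc (G : Tournament V) (σ : Equiv.Perm V) : Prop where
  adj : ∀ v, G.Adj v (σ v)
  source : ∀ v w, G.Adj v w → w = σ v ∨ G.Adj (σ v) w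

theorem IsPrime.exists_isSucc [Finite V] (hG : G.IsPrime) (hL : G.IsLocallyTransitive)
    (hV : 3 ≤ Nat.card V) : ∃ σ, G.IsSucc σ := by
  have h : ∀ v, ∃ u ∈ {u | G.Adj v u}, ∀ w ∈ {u | G.Adj v u}, w = u ∨ G.Adj u w := fun v =>
    exists_source (hG.exists_adj hV v) fun x hx y hy z hz => hL.out hx hy hz
  choose σ h1 h2 using h
  -- If `v → w`, the source `σ v` equals or dominates `w`, whereas `w → σ w`.
  have key : ∀ v w, σ v = σ w → ¬ G.Adj v w := by
    intro v w hvw hadj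
    rcases h2 v w hadj with h | h
    · exact adj_ne (h1 w) (h.trans hvw)
    · rw [hvw] at h
      exact adj_asymm h (h1 w)
  have hinj : Function.Injective σ := by
    intro v w hvw
    by_contra hne
    rcases adj_or_adj (G := G) hne with h | h
    · exact key v w hvw h
    · exact key w v hvw.symm h
  exact ⟨Equiv.ofBijective σ (Finite.injective_iff_bijective.1 hinj), h1, h2⟩

section

variable {σ : Equiv.Perm V}

/-- Otherwise `{v, σ v}` is homogeneous. -/
theorem IsSucc.exists_separating [Finite V] (hσ : G.IsSucc σ) (hG : G.IsPrime)
    (hV : 3 ≤ Nat.card V) (v : V) : ∃ w, G.Adj (σ v) w ∧ G.Adj w v := by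
  by_contra! hcon
  have hne := adj_ne (hσ.adj v)
  have hcard : ({v, σ v} : Set V).ncard = 2 := Set.ncard_pair hne
  refine hG {v, σ v} (fun u hu => ?_) ⟨by omega, by omega⟩
  have huv : u ≠ v := fun e => hu (by simp [e])
  have huσ : u ≠ σ v := fun e => hu (by simp [e])
  rcases adj_or_adj (G := G) huv with h | h
  · left
    rintro x (rfl | rfl)
    · exact h
    · exact adj_of_not_adj huσ.symm fun h' => hcon u h' h
  · right
    rintro x (rfl | rfl)
    · exact h
    · exact (hσ.source _ u h).resolve_left huσ

/-- If `w → w'` both separate, choose `u` separating `w` from `σ w`: the cyclic triangle `w, σ w, u`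
lies in the out-neighbourhood of `σ v`. -/
theorem IsSucc.separating_unique [Finite V] (hσ : G.IsSucc σ) (hG : G.IsPrime)
    (hL : G.IsLocallyTransitive) (hV : 3 ≤ Nat.card V) {v w w' : V} (h1 : G.Adj (σ v) w)
    (h2 : G.Adj w v) (h3 : G.Adj (σ v) w') (h4 : G.Adj w' v) : w = w' := by
  have key : ∀ w w', G.Adj (σ v) w → G.Adj w v → G.Adj (σ v) w' → G.Adj w' v →
      ¬ G.Adj w w' := by
    intro w w' h1 h2 h3 h4 hww
    have hv := hσ.adj v
    have hw := hσ.adj w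
    have hwv : G.Adj (σ w) v := by
      rcases hσ.source w v h2 with h | h
      · rcases hσ.source w w' hww with h' | h'
        · exact absurd (h'.trans h.symm) (adj_ne h4)
        · rw [← h] at h'
          exact absurd h' (adj_asymm h4)
      · exact h
    have hσσ : G.Adj (σ v) (σ w) := by
      refine adj_of_not_adj (fun e => ?_) fun h => ?_
      · exact adj_ne h2 (σ.injective e)
      · rcases hσ.source w w' hww with h' | h'
        · rw [← h'] at h
          exact adj_asymm h3 h
        · exact hL.out hwv h h' hv h3 h4
    obtain ⟨u, hu1, hu2⟩ := hσ.exists_separating hG hV w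
    have huv : u ≠ v := by
      rintro rfl
      exact adj_asymm h2 hu2
    have huσ : u ≠ σ v := by
      rintro rfl
      exact adj_asymm hσσ hu1
    have hvu : G.Adj v u := adj_of_not_adj huv fun h => hL.inn h2 hwv h hw hu1 hu2
    exact hL.out h1 hσσ ((hσ.source v u hvu).resolve_left huσ) hw hu1 hu2
  by_contra hne
  rcases adj_or_adj (G := G) hne with h | h
  · exact key w w' h1 h2 h3 h4 h
  · exact key w' w h3 h4 h1 h2 h

/-- From `v` to `σ v` the out-neighbourhood loses `σ v` and gains the unique separating vertex. -/
theorem IsSucc.ncard_out_apply [Finite V] (hσ : G.IsSucc σ) (hG : G.IsPrime)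
    (hL : G.IsLocallyTransitive) (hV : 3 ≤ Nat.card V) (v : V) :
    {u | G.Adj (σ v) u}.ncard = {u | G.Adj v u}.ncard := by
  obtain ⟨w, hw1, hw2⟩ := hσ.exists_separating hG hV v
  have : {u | G.Adj (σ v) u} = insert w ({u | G.Adj v u} \ {σ v}) := by
    ext u
    constructor
    · intro hu
      by_cases hvu : G.Adj v u
      · exact Or.inr ⟨hvu, fun e => adj_ne hu (Eq.symm e)⟩
      · refine Or.inl (hσ.separating_unique hG hL hV hu (adj_of_not_adj ?_ hvu) hw1 hw2)
        rintro rfl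
        exact adj_asymm (hσ.adj v) hu
    · rintro (rfl | ⟨h, h'⟩)
      · exact hw1
      · exact (hσ.source v u h).resolve_left h'
  rw [this]
  exact Set.ncard_exchange (s := {u | G.Adj v u}) (adj_asymm hw2) (hσ.adj v)

/-- The powers of `σ` list the transitive out-neighbourhood of `v` from its source on; the second
clause, that the unlisted vertices lie beyond `(σ ^ j) v`, drives the induction. -/
theorem IsSucc.adj_pow [Finite V] (hσ : G.IsSucc σ) (hL : G.IsLocallyTransitive) (v : V) (j : ℕ)
    (hj : j ≤ {u | G.Adj v u}.ncard) :
    (∀ i, 1 ≤ i → i ≤ j → G.Adj v ((σ ^ i) v)) ∧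
      ∀ w, G.Adj v w → (∃ i, 1 ≤ i ∧ i ≤ j ∧ w = (σ ^ i) v) ∨ G.Adj ((σ ^ j) v) w := by
  classical
  induction j with
  | zero => exact ⟨fun i h1 h2 => by omega, fun w hw => Or.inr (by simpa using hw)⟩
  | succ j ih =>
  obtain ⟨ih1, ih2⟩ := ih (by omega)
  have hstep : (σ ^ (j + 1)) v = σ ((σ ^ j) v) := by rw [pow_succ', Equiv.Perm.mul_apply]
  have hnew : G.Adj v ((σ ^ (j + 1)) v) := by
    rcases Nat.eq_zero_or_pos j with rfl | hj0
    · simpa using hσ.adj v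
    obtain ⟨w, hvw, hwj⟩ : ∃ w, G.Adj v w ∧ ¬ ∃ i, 1 ≤ i ∧ i ≤ j ∧ w = (σ ^ i) v := by
      by_contra! hcon
      have hsub : {u | G.Adj v u} ⊆ ((Finset.Icc 1 j).image fun i => (σ ^ i) v : Finset V) := by
        intro w hw
        obtain ⟨i, hi1, hi2, rfl⟩ := hcon w hw
        simp only [Finset.coe_image, Finset.coe_Icc]
        exact ⟨i, ⟨hi1, hi2⟩, rfl⟩
      have h1 := Set.ncard_le_ncard hsub
      rw [Set.ncard_coe_finset] at h1
      have h2 : ((Finset.Icc 1 j).image fun i => (σ ^ i) v).card ≤ (Finset.Icc 1 j).card :=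
        Finset.card_image_le
      rw [Nat.card_Icc] at h2
      omega
    have hxw := (ih2 w hvw).resolve_left hwj
    have hvx := ih1 j hj0 le_rfl
    rw [hstep]
    rcases hσ.source _ w hxw with h | h
    · rwa [← h]
    -- An arc back to `v` would close a cyclic triangle `v, x, σ x`, with `x = (σ ^ j) v`, among the
    -- in-neighbours of `w`.
    · refine adj_of_not_adj (fun e => ?_) fun h' => ?_
      · have := hσ.adj ((σ ^ j) v)
        rw [e] at this
        exact adj_asymm hvx this
      · exact hL.inn hvw hxw h hvx (hσ.adj _) h'
  refine ⟨fun i h1 h2 => ?_, fun w hw => ?_⟩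
  · rcases Nat.lt_or_ge j i with h | h
    · obtain rfl : i = j + 1 := by omega
      exact hnew
    · exact ih1 i h1 h
  · rcases ih2 w hw with ⟨i, hi1, hi2, hi3⟩ | h
    · exact Or.inl ⟨i, hi1, by omega, hi3⟩
    · rw [hstep]
      rcases hσ.source _ w h with h' | h'
      · exact Or.inl ⟨j + 1, by omega, le_rfl, h'.trans hstep.symm⟩
      · exact Or.inr h'

theorem IsSucc.adj_iff [Finite V] (hσ : G.IsSucc σ) (hL : G.IsLocallyTransitive) (v u : V) :
    G.Adj v u ↔ ∃ i, 1 ≤ i ∧ i ≤ {u | G.Adj v u}.ncard ∧ u = (σ ^ i) v := by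
  classical
  have hpow := (hσ.adj_pow hL v _ le_rfl).1
  constructor
  swap
  · rintro ⟨i, hi1, hi2, rfl⟩
    exact hpow i hi1 hi2
  intro hu
  set k := {u | G.Adj v u}.ncard with hk
  have hne : ∀ i j, 1 ≤ i → i < j → j ≤ k → (σ ^ i) v ≠ (σ ^ j) v := by
    intro i j hi hij hj h
    have h1 : (σ ^ j) v = (σ ^ i) ((σ ^ (j - i)) v) := by
      rw [← Equiv.Perm.mul_apply, ← pow_add, Nat.add_sub_cancel' hij.le]
    exact adj_ne (hpow (j - i) (by omega) (by omega)) ((σ ^ i).injective (h.trans h1))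
  have hinj : Set.InjOn (fun i => (σ ^ i) v) (Finset.Icc 1 k : Finset ℕ) := by
    intro i hi j hj hij
    simp only [Finset.coe_Icc, Set.mem_Icc] at hi hj
    rcases lt_trichotomy i j with h | h | h
    · exact absurd hij (hne i j hi.1 h hj.2)
    · exact h
    · exact absurd hij.symm (hne j i hj.1 h hi.2)
  have hsub : (((Finset.Icc 1 k).image fun i => (σ ^ i) v : Finset V) : Set V) ⊆
      {u | G.Adj v u} := by
    intro w hw
    obtain ⟨i, hi, rfl⟩ := Finset.mem_image.1 hw
    exact hpow i (Finset.mem_Icc.1 hi).1 (Finset.mem_Icc.1 hi).2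
  have heq := Set.eq_of_subset_of_ncard_le hsub (by
    rw [Set.ncard_coe_finset, Finset.card_image_of_injOn hinj, Nat.card_Icc]
    omega)
  obtain ⟨i, hi, rfl⟩ := Finset.mem_image.1 (heq.ge hu)
  exact ⟨i, (Finset.mem_Icc.1 hi).1, (Finset.mem_Icc.1 hi).2, rfl⟩

/-- Out-neighbours of the orbit of `v` stay in it, so outside vertices dominate the orbit and it is
homogeneous. -/
theorem IsSucc.exists_pow_eq [Finite V] (hσ : G.IsSucc σ) (hG : G.IsPrime)
    (hL : G.IsLocallyTransitive) (v u : V) : ∃ i : ℕ, (σ ^ i) v = u := by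
  by_contra hcon
  have hσ1 : (σ ^ 1) v = σ v := by rw [pow_one]
  refine hG (Set.range fun i : ℕ => (σ ^ i) v) (fun x hx => Or.inl ?_) ⟨?_, ?_⟩
  · rintro _ ⟨i, rfl⟩
    refine adj_of_not_adj (fun e => hx ⟨i, e⟩) fun h => ?_
    obtain ⟨j, -, -, rfl⟩ := (hσ.adj_iff hL _ _).1 h
    exact hx ⟨j + i, by simp only [pow_add, Equiv.Perm.mul_apply]⟩
  · exact (Set.one_lt_ncard (Set.toFinite _)).2
      ⟨v, ⟨0, by simp⟩, σ v, ⟨1, hσ1⟩, adj_ne (hσ.adj v)⟩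
  · rw [← Set.ncard_univ]
    refine Set.ncard_lt_ncard (Set.ssubset_univ_iff.2 fun heq => hcon ?_)
    exact heq.ge (Set.mem_univ u)

theorem IsSucc.pow_eq_pow_iff [Finite V] (hσ : G.IsSucc σ) (hG : G.IsPrime)
    (hL : G.IsLocallyTransitive) (v : V) (i j : ℕ) :
    (σ ^ i) v = (σ ^ j) v ↔ i ≡ j [MOD Nat.card V] := by
  have := Fintype.ofFinite V
  have hcyc : σ.IsCycleOn ((Finset.univ : Finset V) : Set V) := by
    refine ⟨by simp, fun x _ y _ => ?_⟩
    obtain ⟨i, hi⟩ := hσ.exists_pow_eq hG hL x y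
    exact ⟨i, by simpa using hi⟩
  rw [hcyc.pow_apply_eq_pow_apply (Finset.mem_univ v), Finset.card_univ, Nat.card_eq_fintype_card]

end

theorem IsPrime.exists_isIsomorphic_T [Finite V] (hG : G.IsPrime) (hL : G.IsLocallyTransitive)
    (hV : 3 ≤ Nat.card V) : ∃ (n : ℕ) (hn : Odd n), G.IsIsomorphic (T n hn) := by
  obtain ⟨σ, hσ⟩ := hG.exists_isSucc hL hV
  obtain ⟨v⟩ : Nonempty V := (Nat.card_pos_iff.1 (by omega)).1
  set n := Nat.card V with hn
  set k := {u | G.Adj v u}.ncard with hk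
  have hmod := hσ.pow_eq_pow_iff hG hL
  rw [← hn] at hmod
  have hkconst : ∀ w, {u | G.Adj w u}.ncard = k := by
    intro w
    obtain ⟨i, rfl⟩ := hσ.exists_pow_eq hG hL v w
    induction i with
    | zero => rfl
    | succ i ih => rw [pow_succ', Equiv.Perm.mul_apply, hσ.ncard_out_apply hG hL hV, ih]
  have hadj : ∀ i j : ℕ, G.Adj ((σ ^ i) v) ((σ ^ j) v) ↔
      ∃ t, 1 ≤ t ∧ t ≤ k ∧ j ≡ t + i [MOD n] := by
    intro i j
    rw [hσ.adj_iff hL, hkconst]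
    simp only [← Equiv.Perm.mul_apply, ← pow_add, hmod]
  have hk1 : 1 ≤ k := (Set.ncard_pos (Set.toFinite _)).2 ⟨σ v, hσ.adj v⟩
  have hkn : k < n := by
    rw [hn, ← Set.ncard_univ]
    exact Set.ncard_lt_ncard (Set.ssubset_univ_iff.2 fun h => G.loopless v (h.ge (Set.mem_univ v)))
  -- Otherwise `n - k ≤ k`, giving arcs both ways between `v` and `(σ ^ k) v`.
  have hn2 : 2 * k < n := by
    by_contra hcon
    refine adj_asymm ((hadj 0 k).2 ⟨k, hk1, le_rfl, Nat.ModEq.refl _⟩)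
      ((hadj k 0).2 ⟨n - k, by omega, by omega, ?_⟩)
    rw [Nat.sub_add_cancel hkn.le]
    exact (Nat.modEq_zero_iff_dvd.2 dvd_rfl).symm
  -- Otherwise the differences `k + 1` and `n - k - 1` both exceed `k`, leaving `v` and `(σ ^ (k +
  -- 1)) v` without an arc.
  have hn3 : n = 2 * k + 1 := by
    by_contra hcon
    have hne : (σ ^ 0) v ≠ (σ ^ (k + 1)) v := fun h => by
      have := Nat.ModEq.eq_of_lt_of_lt ((hmod v 0 (k + 1)).1 h) (by omega) (by omega)
      omega
    rcases adj_or_adj (G := G) hne with h | h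
    · obtain ⟨t, ht1, ht2, ht3⟩ := (hadj _ _).1 h
      have := Nat.ModEq.eq_of_lt_of_lt ht3 (by omega) (by omega)
      omega
    · obtain ⟨t, ht1, ht2, ht3⟩ := (hadj _ _).1 h
      have := Nat.ModEq.eq_of_lt_of_lt ht3 (by omega) (by omega)
      omega
  refine ⟨n, ⟨k, hn3⟩, ⟨RelIso.symm ⟨Equiv.ofBijective (fun i : Fin n => (σ ^ (i : ℕ)) v) ?_, ?_⟩⟩⟩
  · rw [Nat.bijective_iff_injective_and_card]
    refine ⟨fun i j hij => Fin.ext ?_, by rw [Nat.card_fin]⟩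
    exact Nat.ModEq.eq_of_lt_of_lt ((hmod v _ _).1 hij) i.2 j.2
  · intro i j
    simp only [Equiv.ofBijective_apply]
    rw [hadj]
    refine exists_congr fun t => and_congr_right fun _ => and_congr (by omega) ?_
    rw [← Int.natCast_modEq_iff]
    push_cast
    constructor
    · intro h
      simpa using h.sub_right (i : ℤ)
    · intro h
      simpa using h.add_right (i : ℤ)

/-! ### The converse: both structures exclude `U₅` -/

/-- Eliminating the congruence, whose quotient is 0 or 1, leaves linear inequalities for `omega`. -/
theorem T_adj_iff {m : ℕ} (hn : Odd (2 * m + 1)) (a b : Fin (2 * m + 1)) :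
    (T (2 * m + 1) hn).Adj a b ↔
      ((a : ℕ) < b ∧ (b : ℕ) ≤ a + m) ∨ ((b : ℕ) + m + 1 ≤ a) := by
  have ha := a.isLt
  have hb := b.isLt
  constructor
  · rintro ⟨k, h1, h2, h⟩
    obtain ⟨c, hc⟩ := h.dvd
    have c1 : c < 2 := by
      by_contra hcon
      have : ((2 * m + 1 : ℕ) : ℤ) * 2 ≤ (2 * m + 1 : ℕ) * c := by gcongr; omega
      omega
    have c2 : -1 < c := by
      by_contra hcon
      have : ((2 * m + 1 : ℕ) : ℤ) * c ≤ (2 * m + 1 : ℕ) * (-1) := by gcongr; omega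
      omega
    have : c = 0 ∨ c = 1 := by omega
    rcases this with rfl | rfl <;> omega
  · rintro (⟨h1, h2⟩ | h)
    · refine ⟨(b : ℕ) - a, by omega, by omega, ?_⟩
      rw [Nat.cast_sub h1.le]
    · refine ⟨(b : ℕ) + (2 * m + 1) - a, by omega, by omega, ?_⟩
      rw [Nat.cast_sub (by omega)]
      refine (Int.modEq_iff_dvd).mpr ⟨1, ?_⟩
      push_cast
      ring

theorem T_not_triangle_out {n : ℕ} (hn : Odd n) {v x y z : Fin n} (hx : (T n hn).Adj v x)
    (hy : (T n hn).Adj v y) (hz : (T n hn).Adj v z) (hxy : (T n hn).Adj x y)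
    (hyz : (T n hn).Adj y z) : ¬ (T n hn).Adj z x := by
  obtain ⟨m, rfl⟩ := id hn
  rw [T_adj_iff] at *
  omega

/-- The arcs of `U₅` along an arc-preserving map. -/
theorem exists_arcs_of_hom_U5 {f : Fin 5 → V} (hf : ∀ i j, U5.Adj i j → G.Adj (f i) (f j)) :
    ∃ a b c d e, G.Adj b a ∧ G.Adj a c ∧ G.Adj b c ∧ G.Adj b d ∧ G.Adj c d ∧ G.Adj c e ∧
      G.Adj d e ∧ G.Adj d a ∧ G.Adj e a ∧ G.Adj e b := by
  refine ⟨f 0, f 1, f 2, f 3, f 4, ?_, ?_, ?_, ?_, ?_, ?_, ?_, ?_, ?_, ?_⟩ <;>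
    exact hf _ _ (by unfold U5; decide)

/-- In `U₅` the vertex `v₂` dominates the cyclic triangle `v₁, v₃, v₄`. -/
theorem isFree_of_isIsomorphic_T {n : ℕ} {hn : Odd n} (h : G.IsIsomorphic (T n hn)) :
    G.IsFree U5 := by
  obtain ⟨φ⟩ := h
  refine isFree_iff.2 ?_
  rintro ⟨f, hf⟩
  obtain ⟨a, b, c, d, e, hba, hac, hbc, hbd, hcd, -, -, hda, -, -⟩ := exists_arcs_of_hom_U5 hf
  have key : ∀ {x y}, G.Adj x y → (T n hn).Adj (φ x) (φ y) := fun h => φ.map_rel_iff.2 h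
  exact T_not_triangle_out hn (key hba) (key hbc) (key hbd) (key hac) (key hcd) (key hda)

/-- Each cyclic triangle meets three classes. The triangles `a, c, d` and `a, c, e` then put `d` and
`e` in the same class, against the triangle `d, e, b`. -/
theorem isFree_of_partition {X Y Z : Set V} (hV : X ∪ Y ∪ Z = Set.univ)
    (hXY : G.IsTransitiveSet (X ∪ Y)) (hYZ : G.IsTransitiveSet (Y ∪ Z))
    (hZX : G.IsTransitiveSet (Z ∪ X)) : G.IsFree U5 := by
  rw [isTransitiveSet_iff] at hXY hYZ hZX
  have hcol : ∀ v, ∃ i : ℕ, (i = 0 ∧ v ∈ X) ∨ (i = 1 ∧ v ∈ Y) ∨ (i = 2 ∧ v ∈ Z) := by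
    intro v
    rcases hV.ge (Set.mem_univ v) with (h | h) | h
    · exact ⟨0, Or.inl ⟨rfl, h⟩⟩
    · exact ⟨1, Or.inr (Or.inl ⟨rfl, h⟩)⟩
    · exact ⟨2, Or.inr (Or.inr ⟨rfl, h⟩)⟩
  choose col hcol using hcol
  have hlt : ∀ v, col v < 3 := fun v => by
    have := hcol v
    omega
  have key : ∀ a b c, G.Adj a b → G.Adj b c → G.Adj c a → col a ≠ col b := by
    intro a b c h1 h2 h3 h
    rcases hcol a with ⟨ha, ha'⟩ | ⟨ha, ha'⟩ | ⟨ha, ha'⟩ <;>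
    rcases hcol b with ⟨hb, hb'⟩ | ⟨hb, hb'⟩ | ⟨hb, hb'⟩ <;>
    first
    | omega
    | (rcases hcol c with ⟨hc, hc'⟩ | ⟨hc, hc'⟩ | ⟨hc, hc'⟩ <;>
       first
       | (refine hXY a ?_ b ?_ c ?_ h1 h2 h3 <;> simp [ha', hb', hc']; done)
       | (refine hYZ a ?_ b ?_ c ?_ h1 h2 h3 <;> simp [ha', hb', hc']; done)
       | (refine hZX a ?_ b ?_ c ?_ h1 h2 h3 <;> simp [ha', hb', hc']))
  refine isFree_iff.2 ?_
  rintro ⟨f, hf⟩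
  obtain ⟨a, b, c, d, e, hba, hac, hbc, hbd, hcd, hce, hde, hda, hea, heb⟩ :=
    exists_arcs_of_hom_U5 hf
  have n1 := key a c d hac hcd hda
  have n2 := key c d a hcd hda hac
  have n3 := key d a c hda hac hcd
  have n4 := key c e a hce hea hac
  have n5 := key e a c hea hac hce
  have n6 := key d e b hde heb hbd
  have := hlt a
  have := hlt c
  have := hlt d
  have := hlt e
  omega

end Tournament

theorem theorem1 {V : Type*} [Finite V] (G : Tournament V) (hG : G.IsPrime) :
    G.IsFree Tournament.U5 ↔
      ((∃ (n : ℕ) (hn : Odd n), G.IsIsomorphic (Tournament.T n hn)) ∨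
        ∃ X Y Z : Set V,
          X ∪ Y ∪ Z = Set.univ ∧ Disjoint X Y ∧ Disjoint Y Z ∧ Disjoint Z X ∧
          G.IsTransitiveSet (X ∪ Y) ∧ G.IsTransitiveSet (Y ∪ Z) ∧
          G.IsTransitiveSet (Z ∪ X)) := by
  constructor
  · intro hU
    by_cases hT : ∃ a b c d e, G.IsT5 a b c d e
    · obtain ⟨a, b, c, d, e, h⟩ := hT
      left
      refine hG.exists_isIsomorphic_T (hG.isLocallyTransitive_of_isT5 hU h) ?_
      rw [← Set.ncard_univ]
      exact (Set.two_lt_ncard (Set.toFinite _)).2 ⟨a, trivial, b, trivial, c, trivial,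
        Tournament.adj_ne h.ab, Tournament.adj_ne h.ac, Tournament.adj_ne h.bc⟩
    · push Not at hT
      exact Or.inr (hG.exists_partition hU hT)
  · rintro (⟨n, hn, h⟩ | ⟨X, Y, Z, hV, -, -, -, hXY, hYZ, hZX⟩)
    · exact Tournament.isFree_of_isIsomorphic_T h
    · exact Tournament.isFree_of_partition hV hXY hYZ hZX
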